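/- Virtual knots are represented by diagrams on the sphere with virtual crossings and classical (positive or negative) crossings, up to the classical and virtual Reidemeister moves; a virtual knot is classical if it has a diagram without virtual crossings. A *virtual shadow* $S$ is an oriented virtual knot diagram in which all virtual crossings are given but no classical crossing is determined; each of its undetermined classical crossings (*precrossings*) can be resolved as a positive or as a negative classical crossing, but not as a virtual one. The *virtualizing number* $\mathrm{vir}(S)$ is the minimum number of precrossings that must be resolved so that every resolution of the remaining precrossings yields a non-classical virtual knot; it is $\infty$ if there is no such choice, that is, if every resolution of $S$ is classical. For a precrossing $c$, smoothing at $c$ according to the orientation gives two components $L_1,L_2$. The *intersection index* $\mathrm{ind}(c)$ is the sum of the signs of the precrossings between $L_1$ and $L_2$, where a precrossing has sign $+1$ if the directions of $L_1$ and $L_2$ (in this order) form a positively oriented frame there, and $-1$ otherwise; virtual crossings are not counted. Exchanging $L_1$ and $L_2$ changes only the sign of $\mathrm{ind}(c)$. For $m\ge 0$ let $C_m$ be the set of precrossings $c$ of $S$ with $|\mathrm{ind}(c)|=m$. **Proposition.** For every virtual shadow $S$ in which some precrossing has nonzero intersection index, $$\mathrm{vir}(S)\;\le\;\min_m\left\{\frac{|C_m|}{2}+1\right\},$$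 where $m$ ranges over all positive integers such that there is a precrossing $c$ of $S$ with $|\mathrm{ind}(c)|=m$. -/

import Mathlib

open scoped ENNReal

namespace VirtualKnot

/-! ## Oriented closed curves on the sphere, as cyclic words of passages

An oriented closed curve with transverse double points is recorded by the cyclic sequence of its
passages through the double points.  Each double point `c : ℕ` is passed twice; the two
passages are called `(c, true)` and `(c, false)`, named in such a way that the direction of the
passage `(c, true)` followed by the direction of the passage `(c, false)` is a positively oriented
(counterclockwise) frame.  -/

/-- A passage of the curve through a double point. -/
abbrev Pass := ℕ × Bool

/-- The half-edges of the curve at its double points: `(p, true)` is the half-edge on which the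
curve leaves the passage `p`, and `(p, false)` is the one on which it enters `p`. -/
abbrev Dart := Pass × Bool

/-- The double points that occur in a word. -/
def labels (w : List Pass) : Finset ℕ := (w.map Prod.fst).toFinset

/-- The counterclockwise rotation of the four half-edges at a double point:
out of `(c, true)`, out of `(c, false)`, into `(c, true)`, into `(c, false)`. -/
def rotation : Equiv.Perm Dart where
  toFun
    | ((c, true), true) => ((c, false), true)
    | ((c, false), true) => ((c, true), false)
    | ((c, true), false) => ((c, false), false)
    | ((c, false), false) => ((c, true), true)
  invFun
    | ((c, false), true) => ((c, true), true)
    | ((c, true), false) => ((c, false), true)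
    | ((c, false), false) => ((c, true), false)
    | ((c, true), true) => ((c, false), false)
  left_inv := by rintro ⟨⟨c, _ | _⟩, _ | _⟩ <;> rfl
  right_inv := by rintro ⟨⟨c, _ | _⟩, _ | _⟩ <;> rfl

/-- The involution that exchanges the two ends of each edge: the edge that leaves the passage `p`
enters the cyclically next passage `w.formPerm p`. -/
def edgeFlip (w : List Pass) : Equiv.Perm Dart where
  toFun
    | (p, true) => (w.formPerm p, false)
    | (p, false) => (w.formPerm⁻¹ p, true)
  invFun
    | (p, true) => (w.formPerm p, false)
    | (p, false) => (w.formPerm⁻¹ p, true)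
  left_inv := by rintro ⟨p, _ | _⟩ <;> simp
  right_inv := by rintro ⟨p, _ | _⟩ <;> simp

/-- Walking along the boundary of a face of the combinatorial map: cross the edge, then turn to the
neighbouring half-edge. -/
def faceStep (w : List Pass) : Equiv.Perm Dart := (edgeFlip w).trans rotation

/-- The faces of the combinatorial map: the orbits of `faceStep`. -/
def faces (w : List Pass) : Set (Set Dart) :=
  {F | ∃ d : Dart, d.1 ∈ w ∧ F = {d' | (faceStep w).SameCycle d d'}}

/-- The word is that of a curve on the sphere: it is a circle without double points, or
the (automatically connected) combinatorial map has Euler characteristic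
`vertices - edges + faces = 2`. -/
def IsPlanar (w : List Pass) : Prop :=
  w = [] ∨ ((labels w).card : ℤ) - (w.length : ℤ) + ((faces w).ncard : ℤ) = 2

/-! ## Virtual pseudodiagrams -/

/-- The kinds of crossings in a virtual pseudodiagram.  The writhe of a crossing is positive
exactly when (direction of the over-strand, direction of the under-strand) is a positively oriented
frame.  So the passage `(c, true)` is the over-strand at a positive crossing `c`, and the passage
`(c, false)` is the over-strand at a negative crossing `c`. -/
inductive CrossingKind where
  | virtual
  | positive
  | negative
  | undetermined
  deriving DecidableEq

/-- An (oriented) virtual pseudodiagram: a closed curve on the sphere each of whose double points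
is a virtual crossing, a positive or negative classical crossing, or an undetermined classical
crossing (precrossing).  Values of `kind` at numbers that do not occur in the word are
irrelevant. -/
structure VirtualPseudodiagram where
  word : List Pass
  kind : ℕ → CrossingKind
  nodup : word.Nodup
  paired : ∀ c : ℕ, (c, true) ∈ word ↔ (c, false) ∈ word
  planar : IsPlanar word

namespace VirtualPseudodiagram

variable (P : VirtualPseudodiagram)

/-- All crossings, virtual ones included. -/
def crossings : Finset ℕ := labels P.word

def virtualCrossings : Finset ℕ := P.crossings.filter fun c => P.kind c = .virtual

/-- The crossings that are not virtual, undetermined ones included. -/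
def classicalCrossings : Finset ℕ := P.crossings.filter fun c => P.kind c ≠ .virtual

def precrossings : Finset ℕ := P.crossings.filter fun c => P.kind c = .undetermined

/-- A virtual shadow: all classical crossings are undetermined. -/
def IsVirtualShadow : Prop := ∀ c ∈ P.classicalCrossings, P.kind c = .undetermined

/-- The two components (as sequences of passages) created by smoothing at `c` according to
the orientation: the arc from `(c, true)` to `(c, false)`, and the arc from `(c, false)` to
`(c, true)`. -/
def smoothing (c : ℕ) : List Pass × List Pass :=
  let t := (P.word.rotate (P.word.idxOf (c, true))).tail
  (t.takeWhile (· ≠ (c, false)), (t.dropWhile (· ≠ (c, false))).tail)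

/-- The virtual shadow linking number of two components: the sum of the signs of the non-virtual
crossings between them, the sign being positive when (direction of the first component, direction of
the second component) is a positively oriented frame. -/
def shadowLinkingNumber (L₁ L₂ : List Pass) : ℤ :=
  ∑ x ∈ P.classicalCrossings,
    ((if (x, true) ∈ L₁ ∧ (x, false) ∈ L₂ then 1 else 0)
      - (if (x, false) ∈ L₁ ∧ (x, true) ∈ L₂ then 1 else 0))

/-- The intersection index of a crossing.  Its sign depends on the order in which the two components
are taken. -/
def ind (c : ℕ) : ℤ := P.shadowLinkingNumber (P.smoothing c).1 (P.smoothing c).2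

/-- The set `C_m` of crossings and precrossings with intersection index `m`, up to sign. -/
def crossingsOfIndex (m : ℕ) : Finset ℕ := P.classicalCrossings.filter fun c => |P.ind c| = m

/-- `Q` is obtained from `P` by resolving some (perhaps none, perhaps all) of the precrossings
as positive or negative classical crossings. -/
def IsResolution (Q : VirtualPseudodiagram) : Prop :=
  Q.word = P.word ∧ ∀ c ∈ P.crossings, Q.kind c = P.kind c ∨
    (P.kind c = .undetermined ∧ (Q.kind c = .positive ∨ Q.kind c = .negative))

/-- The precrossings of `P` that are resolved in `Q`. -/
def resolvedCrossings (Q : VirtualPseudodiagram) : Finset ℕ :=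
  P.precrossings.filter fun c => Q.kind c ≠ .undetermined

end VirtualPseudodiagram

/-! ## Virtual knots -/

/-- A virtual knot diagram: no crossing is undetermined. -/
structure VirtualDiagram extends VirtualPseudodiagram where
  determined : ∀ c ∈ toVirtualPseudodiagram.crossings, kind c ≠ .undetermined

/-- Crossing kinds for which the two crossings of a bigon cancel: two virtual crossings, or two
classical crossings at which the same strand passes over (as the two crossings of a bigon have
opposite frames, these are a positive and a negative one). -/
def Cancels (a b : CrossingKind) : Prop :=
  (a = .virtual ∧ b = .virtual) ∨ (a = .positive ∧ b = .negative) ∨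
    (a = .negative ∧ b = .positive)

/-- The classical crossing at which the passage `(c, s)` is the over-strand. -/
def overKind (s : Bool) : CrossingKind := if s then .positive else .negative

/-- The passages `p`, `q` in this order if `o` is true, and in the opposite order otherwise. -/
def inOrder (o : Bool) (p q : Pass) : List Pass := if o then [p, q] else [q, p]

/-- `Triangle k σ a b c`: the two-letter words `a`, `b`, `c` are the passages of three strands
`A`, `B`, `C` around a triangle with crossings `x = A ∩ B`, `y = A ∩ C`, `z = B ∩ C` to which a
third Reidemeister move applies.  The signs `r`, `s`, `t` are the signs of the frames `(A, B)`,
`(A, C)`, `(B, C)`, and `σ` tells on which side of `A ∩ B` the strand `C` passes; for three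
oriented lines in the plane, these signs determine the order of the crossings on each line.
Either `A` has only virtual crossings and the third crossing is arbitrary,
or all three crossings are classical with `A` at the top, `B` in the middle, `C` at the bottom. -/
inductive Triangle (k : ℕ → CrossingKind) (σ : Bool) :
    List Pass → List Pass → List Pass → Prop
  | intro (x y z : ℕ) (r s t : Bool)
      (hk : (k x = .virtual ∧ k y = .virtual) ∨
        (k x = overKind r ∧ k y = overKind s ∧ k z = overKind t)) :
      Triangle k σ
        (inOrder (σ == s) (x, r) (y, s))
        (inOrder (σ == t) (x, !r) (z, t))
        (inOrder (σ == (r == (s == t))) (y, !s) (z, !t))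

/-- The moves on words, with crossing kinds `k`: change of the base point, and the classical,
virtual and mixed Reidemeister moves. -/
inductive Move (k : ℕ → CrossingKind) : List Pass → List Pass → Prop
  | rotate (u v : List Pass) : Move k (u ++ v) (v ++ u)
  | one (u v : List Pass) (c : ℕ) (s : Bool) :
      Move k (u ++ v) (u ++ [(c, s), (c, !s)] ++ v)
  | two_parallel (u v w : List Pass) (x y : ℕ) (s : Bool) (hk : Cancels (k x) (k y)) :
      Move k (u ++ v ++ w) (u ++ [(x, s), (y, !s)] ++ v ++ [(x, !s), (y, s)] ++ w)
  | two_antiparallel (u v w : List Pass) (x y : ℕ) (s : Bool) (hk : Cancels (k x) (k y)) :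
      Move k (u ++ v ++ w) (u ++ [(x, s), (y, !s)] ++ v ++ [(y, s), (x, !s)] ++ w)
  | three_abc (t u v w a b c : List Pass) (σ : Bool) (h : Triangle k σ a b c) :
      Move k (t ++ a ++ u ++ b ++ v ++ c ++ w)
        (t ++ a.reverse ++ u ++ b.reverse ++ v ++ c.reverse ++ w)
  | three_acb (t u v w a b c : List Pass) (σ : Bool) (h : Triangle k σ a b c) :
      Move k (t ++ a ++ u ++ c ++ v ++ b ++ w)
        (t ++ a.reverse ++ u ++ c.reverse ++ v ++ b.reverse ++ w)

namespace VirtualDiagram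

/-- One step between virtual knot diagrams: a renaming of the double points, or one of the
moves. -/
inductive Step : VirtualDiagram → VirtualDiagram → Prop
  | rename (D D' : VirtualDiagram) (f : ℕ → ℕ)
      (hw : D'.word = D.word.map (Prod.map f id))
      (hk : ∀ c ∈ D.crossings, D'.kind (f c) = D.kind c) : Step D D'
  | move (D D' : VirtualDiagram) (k : ℕ → CrossingKind)
      (hD : ∀ c ∈ D.crossings, k c = D.kind c)
      (hD' : ∀ c ∈ D'.crossings, k c = D'.kind c)
      (h : Move k D.word D'.word) : Step D D'

/-- Two diagrams represent the same virtual knot. -/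
def Equivalent : VirtualDiagram → VirtualDiagram → Prop := Relation.EqvGen Step

/-- The virtual crossing number of the virtual knot represented by `D`. -/
noncomputable def virtualCrossingNumber (D : VirtualDiagram) : ℕ :=
  sInf {n | ∃ D' : VirtualDiagram, Equivalent D D' ∧ D'.virtualCrossings.card = n}

/-- The virtual knot represented by `D` is a classical knot. -/
def IsClassical (D : VirtualDiagram) : Prop := D.virtualCrossingNumber = 0

end VirtualDiagram

namespace VirtualPseudodiagram

/-- However the undetermined crossings are resolved, the result is not a classical knot. -/
def NecessarilyNonclassical (P : VirtualPseudodiagram) : Prop :=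
  ∀ D : VirtualDiagram, P.IsResolution D.toVirtualPseudodiagram → ¬ D.IsClassical

/-- The virtualizing number: the least number of precrossings that can be resolved so that the
result is necessarily non-classical (`⊤` if there is no such resolution). -/
noncomputable def vir (P : VirtualPseudodiagram) : ℕ∞ :=
  ⨅ (Q : VirtualPseudodiagram) (_ : P.IsResolution Q ∧ Q.NecessarilyNonclassical),
    ((P.resolvedCrossings Q).card : ℕ∞)

end VirtualPseudodiagram

end VirtualKnot

/-! For each m > 0 the sum of the writhes of the crossings of index ±m is an invariant of virtual
knots. It vanishes on classical knots, because in a planar curve without virtual crossings every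
intersection index is zero. The index of a crossing depends on the curve and on which crossings are
virtual, not on how precrossings are resolved. Hence once more than half of C_m has been resolved
positively, every completion has a positive index writhe and is non-classical; ⌊|C_m|/2⌋ + 1
crossings suffice, and they exist because C_m is nonempty.

Indices are expressed by heights, the partial sums of frame signs along the word (`ind_eq_index`).
Invariance (`Move.indexWrithe_eq`) then reduces to tracking how each move changes heights. Vanishing
(`index_eq_zero_of_isPlanar`) rests on an Alexander numbering: Euler characteristic 2 forces the
first rational homology of the surface to be zero, so the unit flow along the curve is the jump of a
function on faces. Up to sign and a constant, heights are the values of this function along the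
curve. -/

namespace VirtualKnot

/-! ## Heights and indices in words -/

/-- The sum of `g` over the passages that precede `p` in `w`. -/
def height (g : Pass → ℤ) (w : List Pass) (p : Pass) : ℤ :=
  ((w.takeWhile (· ≠ p)).map g).sum

/-- The sign that a passage contributes to intersection indices. -/
def passSign (k : ℕ → CrossingKind) (p : Pass) : ℤ :=
  if k p.1 = .virtual then 0 else if p.2 then 1 else -1

/-- The intersection index of a classical crossing, in terms of heights. -/
def index (k : ℕ → CrossingKind) (w : List Pass) (c : ℕ) : ℤ :=
  height (passSign k) w (c, false) - height (passSign k) w (c, true) - 1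

/-- The writhe of a crossing, which is zero unless the crossing is positive or negative. -/
def CrossingKind.sign : CrossingKind → ℤ
  | .positive => 1
  | .negative => -1
  | _ => 0

/-- The contribution of a passage to `indexWrithe`. -/
def writheTerm (m : ℕ) (k : ℕ → CrossingKind) (w : List Pass) (p : Pass) : ℤ :=
  if p.2 = true ∧ |index k w p.1| = m then (k p.1).sign else 0

/-- The sum of the writhes of the crossings of index `m` or `-m`. -/
def indexWrithe (m : ℕ) (k : ℕ → CrossingKind) (w : List Pass) : ℤ :=
  (w.map (writheTerm m k w)).sum

section height

variable {g : Pass → ℤ} {u v w : List Pass} {p : Pass}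

@[simp] lemma height_cons (a : Pass) :
    height g (a :: w) p = if a = p then 0 else g a + height g w p := by
  by_cases h : a = p <;> simp [height, h]

lemma height_append_of_mem (h : p ∈ u) : height g (u ++ v) p = height g u p := by
  induction u with
  | nil => simp at h
  | cons a u ih =>
    by_cases ha : a = p
    · simp [ha]
    · have : p ∈ u := by simpa [Ne.symm ha] using h
      simp [ha, ih this]

lemma height_append_of_notMem (h : p ∉ u) :
    height g (u ++ v) p = (u.map g).sum + height g v p := by
  induction u with
  | nil => simp
  | cons a u ih =>
    simp only [List.mem_cons, not_or] at h
    simp [Ne.symm h.1, ih h.2, add_assoc]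

lemma height_congr {g' : Pass → ℤ} (h : ∀ q ∈ w, g q = g' q) : height g w p = height g' w p := by
  unfold height
  rw [List.map_congr_left fun q hq => h q (List.takeWhile_subset _ hq)]

lemma height_insert {B : List Pass} (hB : (B.map g).sum = 0) (hp : p ∉ B) :
    height g (u ++ (B ++ v)) p = height g (u ++ v) p := by
  by_cases hu : p ∈ u
  · simp [height_append_of_mem hu]
  · simp [height_append_of_notMem hu, height_append_of_notMem hp, hB]

/-- The total sum is zero, so cutting the cyclic word elsewhere shifts all heights by one constant,
which differences of heights do not see. -/
lemma height_rotate (hs : ((u ++ v).map g).sum = 0) (hd : (u ++ v).Nodup) (hp : p ∈ u ++ v) :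
    height g (v ++ u) p = height g (u ++ v) p - (u.map g).sum := by
  have hd' := List.nodup_append'.1 hd
  simp only [List.map_append, List.sum_append] at hs
  by_cases hu : p ∈ u
  · have hv : p ∉ v := fun hv => hd'.2.2 hu hv
    rw [height_append_of_mem hu, height_append_of_notMem hv]
    linarith
  · have hv : p ∈ v := by simpa [hu] using hp
    rw [height_append_of_mem hv, height_append_of_notMem hu]
    ring

/-- The change of heights when two adjacent passages are exchanged. -/
def swapChange (g : Pass → ℤ) (o : Bool) (a b p : Pass) : ℤ :=
  (if o then 1 else -1) * ((if p = a then g b else 0) - (if p = b then g a else 0))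

lemma height_swap {o : Bool} {a b : Pass} (hd : (u ++ (inOrder o a b ++ v)).Nodup) :
    height g (u ++ ((inOrder o a b).reverse ++ v)) p =
      height g (u ++ (inOrder o a b ++ v)) p + swapChange g o a b p := by
  have hd' := List.nodup_append'.1 hd
  by_cases hu : p ∈ u
  · have : p ∉ inOrder o a b := fun h => hd'.2.2 hu (by simp [h])
    have hab : p ≠ a ∧ p ≠ b := by cases o <;> simp_all [inOrder]
    simp [height_append_of_mem hu, swapChange, hab]
  · rw [height_append_of_notMem hu, height_append_of_notMem hu]
    have hne : a ≠ b := by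
      rintro rfl
      cases o <;> simp [inOrder] at hd'
    by_cases ha : p = a
    · subst ha
      cases o <;> simp [inOrder, swapChange, hne, hne.symm]
    · by_cases hb : p = b
      · subst hb
        cases o <;> simp [inOrder, swapChange, hne, hne.symm]
      · cases o <;> simp [inOrder, swapChange, ha, hb, Ne.symm ha, Ne.symm hb] <;> ring

end height

lemma mem_labels {w : List Pass} {c : ℕ} : c ∈ labels w ↔ ∃ b, (c, b) ∈ w := by
  simp [labels]

lemma sum_eq_zero_of_paired {w : List Pass} (hd : w.Nodup)
    (hp : ∀ c : ℕ, (c, true) ∈ w ↔ (c, false) ∈ w) {g : Pass → ℤ}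
    (hg : ∀ c, g (c, true) + g (c, false) = 0) : (w.map g).sum = 0 := by
  rw [← List.sum_toFinset g hd]
  refine Finset.sum_involution (fun p _ => (p.1, !p.2)) ?_ ?_ ?_ ?_
  · rintro ⟨c, _ | _⟩ _
    · simpa [add_comm] using hg c
    · simpa using hg c
  · rintro ⟨c, _ | _⟩ _ _ <;> simp
  · rintro ⟨c, _ | _⟩ h
    · simpa [hp] using h
    · simpa [hp] using h
  · rintro ⟨c, _ | _⟩ _ <;> rfl

lemma passSign_add (k : ℕ → CrossingKind) (c : ℕ) :
    passSign k (c, true) + passSign k (c, false) = 0 := by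
  by_cases h : k c = .virtual <;> simp [passSign, h]

section congr

variable {k k' : ℕ → CrossingKind} {w : List Pass}

lemma index_congr (h : ∀ c ∈ labels w, (k c = .virtual ↔ k' c = .virtual)) (c : ℕ) :
    index k w c = index k' w c := by
  have : ∀ q ∈ w, passSign k q = passSign k' q := fun q hq => by
    simp [passSign, h q.1 (mem_labels.2 ⟨q.2, hq⟩)]
  simp only [index, height_congr this]

lemma indexWrithe_congr (m : ℕ) (h : ∀ c ∈ labels w, k c = k' c) :
    indexWrithe m k w = indexWrithe m k' w := by
  unfold indexWrithe
  congr 1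
  refine List.map_congr_left fun p hp => ?_
  have hi := index_congr (k := k) (k' := k') (w := w) (fun c hc => by rw [h c hc]) p.1
  simp only [writheTerm, hi, h p.1 (mem_labels.2 ⟨p.2, hp⟩)]

end congr

/-! ## Invariance of the index writhe -/

lemma writheTerm_congr {m : ℕ} {k : ℕ → CrossingKind} {w w' : List Pass} {p : Pass}
    (h : k p.1 ≠ .virtual → index k w p.1 = index k w' p.1) :
    writheTerm m k w p = writheTerm m k w' p := by
  by_cases hk : k p.1 = .virtual
  · simp [writheTerm, hk, CrossingKind.sign]
  · simp [writheTerm, h hk]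

/-- For moves that only reorder passages. Virtual crossings have writhe zero, so their indices are
free to change. -/
lemma indexWrithe_of_perm {m : ℕ} {k : ℕ → CrossingKind} {w w' : List Pass} (hw : w.Perm w')
    (h : ∀ p ∈ w, k p.1 ≠ .virtual → index k w p.1 = index k w' p.1) :
    indexWrithe m k w = indexWrithe m k w' := by
  unfold indexWrithe
  rw [← (hw.map _).sum_eq]
  congr 1
  exact List.map_congr_left fun p hp => writheTerm_congr (h p hp)

lemma indexWrithe_rotate (m : ℕ) (k : ℕ → CrossingKind) {u v : List Pass} (hd : (u ++ v).Nodup)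
    (hp : ∀ c : ℕ, (c, true) ∈ u ++ v ↔ (c, false) ∈ u ++ v) :
    indexWrithe m k (u ++ v) = indexWrithe m k (v ++ u) := by
  refine indexWrithe_of_perm List.perm_append_comm ?_
  rintro ⟨c, b⟩ hc -
  have ht : (c, true) ∈ u ++ v := by cases b; exacts [(hp c).2 hc, hc]
  have hs := sum_eq_zero_of_paired hd hp (passSign_add k)
  simp only [index, height_rotate hs hd ht, height_rotate hs hd ((hp c).1 ht)]
  ring

/-- The kink has zero sum and leaves the other heights alone, while its own crossing has index 0,
which m > 0 excludes. -/
lemma indexWrithe_one {m : ℕ} (hm : 0 < m) (k : ℕ → CrossingKind) (u v : List Pass) (c : ℕ)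
    (s : Bool) (hd : (u ++ [(c, s), (c, !s)] ++ v).Nodup) :
    indexWrithe m k (u ++ v) = indexWrithe m k (u ++ [(c, s), (c, !s)] ++ v) := by
  have hc : ∀ b, (c, b) ∉ u ∧ (c, b) ∉ v := by
    intro b
    simp only [List.append_assoc, List.nodup_append', List.disjoint_left] at hd
    cases s <;> cases b <;> grind
  have hs : (([(c, s), (c, !s)] : List Pass).map (passSign k)).sum = 0 := by
    have := passSign_add k c
    cases s <;> simp <;> linarith
  have hne : ∀ p ∈ u ++ v, writheTerm m k (u ++ v) p =
      writheTerm m k (u ++ ([(c, s), (c, !s)] ++ v)) p := by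
    rintro ⟨x, b⟩ hx
    refine writheTerm_congr fun _ => ?_
    have hxc : x ≠ c := by
      rintro rfl
      have := hc b
      simp_all
    simp only [index]
    rw [height_insert hs (by simp [hxc]), height_insert hs (by simp [hxc])]
  -- The two passages are adjacent, so their heights differ only by the sign of `c` itself, which
  -- the `- 1` in `index` removes.
  have h0 : k c ≠ .virtual → index k (u ++ ([(c, s), (c, !s)] ++ v)) c = 0 := by
    intro hk
    simp only [index, height_append_of_notMem (hc _).1]
    cases s <;> simp [passSign, hk]
  have hz : ∀ b, writheTerm m k (u ++ ([(c, s), (c, !s)] ++ v)) (c, b) = 0 := by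
    intro b
    by_cases hk : k c = .virtual
    · simp [writheTerm, hk, CrossingKind.sign]
    · have : (0 : ℤ) ≠ m := by exact_mod_cast hm.ne
      simp only [writheTerm, h0 hk, abs_zero, this, and_false, if_false]
  rw [List.append_assoc]
  unfold indexWrithe
  rw [List.map_congr_left hne]
  simp only [List.map_append, List.sum_append, List.map_cons, hz]
  simp

/-! ### The second Reidemeister move -/

lemma passSign_add_of_cancels {k : ℕ → CrossingKind} {x y : ℕ} (h : Cancels (k x) (k y))
    (s : Bool) : passSign k (x, s) + passSign k (y, !s) = 0 := by
  rcases h with ⟨h, h'⟩ | ⟨h, h'⟩ | ⟨h, h'⟩ <;> cases s <;> simp [passSign, h, h']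

lemma indexWrithe_two (m : ℕ) (k : ℕ → CrossingKind) (u v w B : List Pass) (x y : ℕ) (s : Bool)
    (hk : Cancels (k x) (k y)) (hB : B = [(x, !s), (y, s)] ∨ B = [(y, s), (x, !s)])
    (hd : (u ++ ([(x, s), (y, !s)] ++ (v ++ (B ++ w)))).Nodup) :
    indexWrithe m k (u ++ (v ++ w)) =
      indexWrithe m k (u ++ ([(x, s), (y, !s)] ++ (v ++ (B ++ w)))) := by
  have hxy : x ≠ y := by
    rintro rfl
    simp only [List.nodup_append', List.disjoint_left] at hd
    rcases hB with rfl | rfl <;> cases s <;> simp at hd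
  have hc : ∀ b, ((x, b) ∉ u ∧ (x, b) ∉ v ∧ (x, b) ∉ w) ∧
      ((y, b) ∉ u ∧ (y, b) ∉ v ∧ (y, b) ∉ w) := by
    intro b
    simp only [List.nodup_append', List.disjoint_left] at hd
    rcases hB with rfl | rfl <;> cases s <;> cases b <;> grind
  have hs : (([(x, s), (y, !s)] : List Pass).map (passSign k)).sum = 0 := by
    have := passSign_add_of_cancels hk s
    simpa using this
  have hs' : (B.map (passSign k)).sum = 0 := by
    have := passSign_add_of_cancels hk (!s)
    rcases hB with rfl | rfl <;> simp at this ⊢ <;> linarith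
  have hne : ∀ p ∈ u ++ (v ++ w), writheTerm m k (u ++ (v ++ w)) p =
      writheTerm m k (u ++ ([(x, s), (y, !s)] ++ (v ++ (B ++ w)))) p := by
    rintro ⟨z, b⟩ hz
    refine writheTerm_congr fun _ => ?_
    have hzx : z ≠ x := by
      rintro rfl
      have := (hc b).1
      simp_all
    have hzy : z ≠ y := by
      rintro rfl
      have := (hc b).2
      simp_all
    have hzB : ∀ b, (z, b) ∉ B := by
      rcases hB with rfl | rfl <;> simp [hzx, hzy]
    have e (b) : height (passSign k) (u ++ ([(x, s), (y, !s)] ++ (v ++ (B ++ w)))) (z, b) =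
        height (passSign k) (u ++ (v ++ w)) (z, b) := by
      rw [height_insert hs (by simp [hzx, hzy]), ← List.append_assoc u v (B ++ w),
        height_insert hs' (hzB b), List.append_assoc]
    simp only [index, e]
  -- The index is oriented by the frame, not by over and under, and the frames in a bigon are
  -- opposite. Hence the indices agree only in absolute value, while the writhes cancel.
  have hi : k x ≠ .virtual → k y ≠ .virtual →
      index k (u ++ ([(x, s), (y, !s)] ++ (v ++ (B ++ w)))) x =
        -index k (u ++ ([(x, s), (y, !s)] ++ (v ++ (B ++ w)))) y := by
    intro hkx hky
    simp only [index, height_append_of_notMem (hc _).1.1, height_append_of_notMem (hc _).2.1]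
    rcases hB with rfl | rfl <;> cases s <;>
      simp [passSign, hkx, hky, hxy, hxy.symm, height_append_of_notMem (hc _).1.2.1,
        height_append_of_notMem (hc _).2.2.1] <;> ring
  have hz : writheTerm m k (u ++ ([(x, s), (y, !s)] ++ (v ++ (B ++ w)))) (x, true) +
      writheTerm m k (u ++ ([(x, s), (y, !s)] ++ (v ++ (B ++ w)))) (y, true) = 0 := by
    rcases hk with ⟨h, h'⟩ | ⟨h, h'⟩ | ⟨h, h'⟩
    · simp [writheTerm, h, h', CrossingKind.sign]
    all_goals
      simp only [writheTerm, h, h', CrossingKind.sign,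
        hi (by simp [h]) (by simp [h']), abs_neg]
      split_ifs <;> simp
  have hf : ∀ c, writheTerm m k (u ++ ([(x, s), (y, !s)] ++ (v ++ (B ++ w)))) (c, false) = 0 := by
    simp [writheTerm]
  have e (g : Pass → ℤ) : ((u ++ ([(x, s), (y, !s)] ++ (v ++ (B ++ w)))).map g).sum =
      ((u ++ (v ++ w)).map g).sum + (g (x, true) + g (y, true)) + (g (x, false) + g (y, false)) := by
    rcases hB with rfl | rfl <;> cases s <;> simp <;> ring
  unfold indexWrithe
  rw [List.map_congr_left hne, e, hz, hf, hf]
  simp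

/-! ### The third Reidemeister move -/

lemma height_three {g : Pass → ℤ} {t u v w : List Pass} {o₁ o₂ o₃ : Bool}
    {a₁ b₁ a₂ b₂ a₃ b₃ p : Pass}
    (hd : (t ++ inOrder o₁ a₁ b₁ ++ u ++ inOrder o₂ a₂ b₂ ++ v ++ inOrder o₃ a₃ b₃ ++ w).Nodup) :
    height g (t ++ (inOrder o₁ a₁ b₁).reverse ++ u ++ (inOrder o₂ a₂ b₂).reverse ++ v ++
        (inOrder o₃ a₃ b₃).reverse ++ w) p =
      height g (t ++ inOrder o₁ a₁ b₁ ++ u ++ inOrder o₂ a₂ b₂ ++ v ++ inOrder o₃ a₃ b₃ ++ w) p +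
        swapChange g o₁ a₁ b₁ p + swapChange g o₂ a₂ b₂ p + swapChange g o₃ a₃ b₃ p := by
  have e₁ := height_swap (g := g) (p := p) (u := t) (o := o₁) (a := a₁) (b := b₁)
    (v := u ++ inOrder o₂ a₂ b₂ ++ v ++ inOrder o₃ a₃ b₃ ++ w) (by simpa using hd)
  have hd₁ : (t ++ (inOrder o₁ a₁ b₁).reverse ++ u ++ inOrder o₂ a₂ b₂ ++ v ++
      inOrder o₃ a₃ b₃ ++ w).Nodup := by
    refine (List.Perm.nodup_iff ?_).2 hd
    gcongr
    exact List.reverse_perm _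
  have e₂ := height_swap (g := g) (p := p) (u := t ++ (inOrder o₁ a₁ b₁).reverse ++ u) (o := o₂)
    (a := a₂) (b := b₂) (v := v ++ inOrder o₃ a₃ b₃ ++ w) (by simpa using hd₁)
  have hd₂ : (t ++ (inOrder o₁ a₁ b₁).reverse ++ u ++ (inOrder o₂ a₂ b₂).reverse ++ v ++
      inOrder o₃ a₃ b₃ ++ w).Nodup := by
    refine (List.Perm.nodup_iff ?_).2 hd₁
    gcongr
    exact List.reverse_perm _
  have e₃ := height_swap (g := g) (p := p)
    (u := t ++ (inOrder o₁ a₁ b₁).reverse ++ u ++ (inOrder o₂ a₂ b₂).reverse ++ v) (o := o₃)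
    (a := a₃) (b := b₃) (v := w) (by simpa using hd₂)
  simp only [List.append_assoc] at e₁ e₂ e₃ ⊢
  rw [e₃, e₂, e₁]

/-- The total change of heights at the passages around a triangle. -/
def triangleChange (g : Pass → ℤ) (σ : Bool) (x y z : ℕ) (r s t : Bool) (p : Pass) : ℤ :=
  swapChange g (σ == s) (x, r) (y, s) p + swapChange g (σ == t) (x, !r) (z, t) p +
    swapChange g (σ == (r == (s == t))) (y, !s) (z, !t) p

/-- With signs as ±1, so that `==` is multiplication, in the classical case both passages of x
change height by σ, both of y by -σrs, and both of z by σrt. In the other case only passages of z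
exchange with virtual ones, of sign zero. -/
lemma triangleChange_eq {k : ℕ → CrossingKind} {σ : Bool} {x y z : ℕ} {r s t : Bool}
    (hk : (k x = .virtual ∧ k y = .virtual) ∨
      (k x = overKind r ∧ k y = overKind s ∧ k z = overKind t))
    (hxy : x ≠ y) (hxz : x ≠ z) (hyz : y ≠ z) {c : ℕ} (hc : k c ≠ .virtual) :
    triangleChange (passSign k) σ x y z r s t (c, false) =
      triangleChange (passSign k) σ x y z r s t (c, true) := by
  rcases hk with ⟨hx, hy⟩ | ⟨hx, hy, hz⟩
  · have hcx : c ≠ x := by rintro rfl; exact hc hx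
    have hcy : c ≠ y := by rintro rfl; exact hc hy
    simp [triangleChange, swapChange, hcx, hcy, passSign, hx, hy]
  · have ho : ∀ b, overKind b ≠ .virtual := by intro b; cases b <;> simp [overKind]
    have hgx : ∀ b, passSign k (x, b) = if b then 1 else -1 := by simp [passSign, hx, ho]
    have hgy : ∀ b, passSign k (y, b) = if b then 1 else -1 := by simp [passSign, hy, ho]
    have hgz : ∀ b, passSign k (z, b) = if b then 1 else -1 := by simp [passSign, hz, ho]
    unfold triangleChange swapChange
    by_cases h₁ : c = x
    · subst h₁
      simp only [Prod.mk.injEq, hxy, hxz, hgy, hgz, true_and, false_and, if_false]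
      cases σ <;> cases r <;> cases s <;> cases t <;> rfl
    · by_cases h₂ : c = y
      · subst h₂
        simp only [Prod.mk.injEq, hxy.symm, hyz, hgx, hgz, true_and, false_and, if_false]
        cases σ <;> cases r <;> cases s <;> cases t <;> rfl
      · by_cases h₃ : c = z
        · subst h₃
          simp only [Prod.mk.injEq, hxz.symm, hyz.symm, hgx, hgy, true_and, false_and, if_false]
          cases σ <;> cases r <;> cases s <;> cases t <;> rfl
        · simp [h₁, h₂, h₃]

/-- A label has only two passages, so two equal labels would force a repetition among the six.
`Subperm` makes this usable for both cyclic orders of the strands. -/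
lemma Triangle.ne {x y z : ℕ} {r s t o₁ o₂ o₃ : Bool} {l : List Pass} (hd : l.Nodup)
    (hl : (inOrder o₁ (x, r) (y, s) ++ inOrder o₂ (x, !r) (z, t) ++
      inOrder o₃ (y, !s) (z, !t)).Subperm l) : x ≠ y ∧ x ≠ z ∧ y ≠ z := by
  obtain ⟨l', hl', hs⟩ := hl
  have h := hl'.nodup_iff.1 (hd.sublist hs)
  refine ⟨?_, ?_, ?_⟩ <;> rintro rfl <;>
    cases o₁ <;> cases o₂ <;> cases o₃ <;> simp [inOrder] at h <;> grind

lemma indexWrithe_three_abc (m : ℕ) {k : ℕ → CrossingKind} {σ : Bool} {t u v w a b c : List Pass}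
    (h : Triangle k σ a b c) (hd : (t ++ a ++ u ++ b ++ v ++ c ++ w).Nodup) :
    indexWrithe m k (t ++ a ++ u ++ b ++ v ++ c ++ w) =
      indexWrithe m k (t ++ a.reverse ++ u ++ b.reverse ++ v ++ c.reverse ++ w) := by
  obtain ⟨x, y, z, r, s, τ, hk⟩ := h
  obtain ⟨hxy, hxz, hyz⟩ := Triangle.ne hd (o₁ := σ == s) (o₂ := σ == τ)
    (o₃ := σ == (r == (s == τ))) (x := x) (y := y) (z := z) (r := r) (s := s) (t := τ) (by
      refine List.Sublist.subperm ?_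
      simp only [List.append_assoc]
      refine List.Sublist.trans (.append_left ?_ _) (List.sublist_append_right t _)
      refine List.Sublist.trans (.append_left ?_ _) (List.sublist_append_right u _)
      exact (List.sublist_append_left _ _).trans (List.sublist_append_right v _))
  refine indexWrithe_of_perm ?_ fun p _ hp => ?_
  · gcongr <;> exact (List.reverse_perm _).symm
  · have := triangleChange_eq (σ := σ) hk hxy hxz hyz hp
    simp only [triangleChange] at this
    simp only [index, height_three hd]
    linarith

lemma indexWrithe_three_acb (m : ℕ) {k : ℕ → CrossingKind} {σ : Bool} {t u v w a b c : List Pass}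
    (h : Triangle k σ a b c) (hd : (t ++ a ++ u ++ c ++ v ++ b ++ w).Nodup) :
    indexWrithe m k (t ++ a ++ u ++ c ++ v ++ b ++ w) =
      indexWrithe m k (t ++ a.reverse ++ u ++ c.reverse ++ v ++ b.reverse ++ w) := by
  obtain ⟨x, y, z, r, s, τ, hk⟩ := h
  obtain ⟨hxy, hxz, hyz⟩ := Triangle.ne hd (o₁ := σ == s) (o₂ := σ == τ)
    (o₃ := σ == (r == (s == τ))) (x := x) (y := y) (z := z) (r := r) (s := s) (t := τ) (by
      rw [List.append_assoc]
      refine (List.perm_append_comm.append_left _).subperm.trans (List.Sublist.subperm ?_)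
      simp only [List.append_assoc]
      refine List.Sublist.trans (.append_left ?_ _) (List.sublist_append_right t _)
      refine List.Sublist.trans (.append_left ?_ _) (List.sublist_append_right u _)
      exact (List.sublist_append_left _ _).trans (List.sublist_append_right v _))
  refine indexWrithe_of_perm ?_ fun p _ hp => ?_
  · gcongr <;> exact (List.reverse_perm _).symm
  · have := triangleChange_eq (σ := σ) hk hxy hxz hyz hp
    simp only [triangleChange] at this
    simp only [index, height_three hd]
    linarith

lemma Move.indexWrithe_eq {m : ℕ} (hm : 0 < m) {k : ℕ → CrossingKind} {w w' : List Pass}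
    (h : Move k w w') (hd : w.Nodup) (hd' : w'.Nodup)
    (hp : ∀ c : ℕ, (c, true) ∈ w ↔ (c, false) ∈ w) :
    indexWrithe m k w = indexWrithe m k w' := by
  cases h with
  | rotate u v => exact indexWrithe_rotate m k hd hp
  | one u v c s => exact indexWrithe_one hm k u v c s hd'
  | two_parallel u v w x y s hk =>
    simp only [List.append_assoc] at hd' ⊢
    exact indexWrithe_two m k u v w _ x y s hk (.inl rfl) hd'
  | two_antiparallel u v w x y s hk =>
    simp only [List.append_assoc] at hd' ⊢
    exact indexWrithe_two m k u v w _ x y s hk (.inr rfl) hd'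
  | three_abc t u v w a b c σ h => exact indexWrithe_three_abc m h hd
  | three_acb t u v w a b c σ h => exact indexWrithe_three_acb m h hd

/-! ### Renamings and equivalence of diagrams -/

lemma height_map {g g' : Pass → ℤ} {f : Pass → Pass} {w : List Pass} {p : Pass}
    (hf : ∀ q ∈ w, f q = f p → q = p) (hg : ∀ q ∈ w, g' (f q) = g q) :
    height g' (w.map f) (f p) = height g w p := by
  induction w with
  | nil => simp [height]
  | cons a w ih =>
    have h₁ : f a = f p ↔ a = p := ⟨hf a (by simp), fun h => by rw [h]⟩
    simp only [List.map_cons, height_cons, h₁, hg a (by simp)]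
    rw [ih (fun q hq => hf q (by simp [hq])) (fun q hq => hg q (by simp [hq]))]

lemma indexWrithe_rename (m : ℕ) {k k' : ℕ → CrossingKind} {w : List Pass} {f : ℕ → ℕ}
    (hp : ∀ c : ℕ, (c, true) ∈ w ↔ (c, false) ∈ w) (hd : (w.map (Prod.map f id)).Nodup)
    (hk : ∀ c ∈ labels w, k' (f c) = k c) :
    indexWrithe m k' (w.map (Prod.map f id)) = indexWrithe m k w := by
  -- Injectivity on the passages that occur is forced by the renamed word having no repetition.
  have hinj : ∀ q ∈ w, ∀ p ∈ w, (Prod.map f id q : Pass) = Prod.map f id p → q = p :=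
    fun q hq p hp h => List.inj_on_of_nodup_map hd hq hp h
  have hg : ∀ q ∈ w, passSign k' (Prod.map f id q) = passSign k q := fun q hq => by
    simp [passSign, hk q.1 (mem_labels.2 ⟨q.2, hq⟩)]
  unfold indexWrithe
  rw [List.map_map]
  congr 1
  refine List.map_congr_left ?_
  rintro ⟨c, b⟩ hc
  have ht : (c, true) ∈ w := by cases b; exacts [(hp c).2 hc, hc]
  have e₁ := height_map (p := (c, true)) (fun q hq => hinj q hq _ ht) hg
  have e₂ := height_map (p := (c, false)) (fun q hq => hinj q hq _ ((hp c).1 ht)) hg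
  simp only [Prod.map_apply, id_eq] at e₁ e₂
  have hi : index k' (w.map (Prod.map f id)) (f c) = index k w c := by simp only [index, e₁, e₂]
  simp [writheTerm, hi, hk c (mem_labels.2 ⟨b, hc⟩)]

namespace VirtualDiagram

lemma Step.indexWrithe_eq {m : ℕ} (hm : 0 < m) {D D' : VirtualDiagram} (h : Step D D') :
    indexWrithe m D.kind D.word = indexWrithe m D'.kind D'.word := by
  cases h with
  | rename f hw hk =>
    have := indexWrithe_rename m (k := D.kind) (k' := D'.kind) D.paired (hw ▸ D'.nodup) hk
    rw [hw, this]
  | move k hD hD' h =>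
    rw [← indexWrithe_congr m hD, ← indexWrithe_congr m hD']
    exact h.indexWrithe_eq hm D.nodup D'.nodup D.paired

lemma Equivalent.indexWrithe_eq {m : ℕ} (hm : 0 < m) {D D' : VirtualDiagram}
    (h : Equivalent D D') : indexWrithe m D.kind D.word = indexWrithe m D'.kind D'.word := by
  induction h with
  | rel _ _ h => exact h.indexWrithe_eq hm
  | refl => rfl
  | symm _ _ _ ih => exact ih.symm
  | trans _ _ _ _ _ ih₁ ih₂ => exact ih₁.trans ih₂

end VirtualDiagram

/-! ## Alexander numberings of planar words -/

section planar

variable {w : List Pass}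

/-- The curve is a single cycle; this is the form in which connectedness is used. -/
lemma forall_mem_of_formPerm (hd : w.Nodup) {Q : Pass → Prop} {p₀ : Pass} (h₀ : p₀ ∈ w)
    (hQ : Q p₀) (hs : ∀ p ∈ w, Q p → Q (w.formPerm p)) : ∀ p ∈ w, Q p := by
  intro p hp
  have hc : w.formPerm.IsCycleOn (w.toFinset : Set Pass) := by
    simpa using hd.isCycleOn_formPerm
  obtain ⟨n, -, rfl⟩ := hc.exists_pow_eq (List.mem_toFinset.2 h₀) (List.mem_toFinset.2 hp)
  have : ∀ n : ℕ, (w.formPerm ^ n) p₀ ∈ w ∧ Q ((w.formPerm ^ n) p₀) := by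
    intro n
    induction n with
    | zero => exact ⟨h₀, hQ⟩
    | succ n ih =>
      rw [pow_succ', Equiv.Perm.mul_apply]
      exact ⟨List.formPerm_apply_mem_of_mem ih.1, hs _ ih.1 ih.2⟩
  exact (this n).2

lemma formPerm_inv_mem {p : Pass} : w.formPerm⁻¹ p ∈ w ↔ p ∈ w := by
  rw [← List.formPerm_mem_iff_mem]
  simp

lemma edgeFlip_mem {d : Dart} : (edgeFlip w d).1 ∈ w ↔ d.1 ∈ w := by
  obtain ⟨p, _ | _⟩ := d
  · exact formPerm_inv_mem
  · exact List.formPerm_mem_iff_mem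

lemma edgeFlip_edgeFlip (d : Dart) : edgeFlip w (edgeFlip w d) = d :=
  (edgeFlip w).left_inv d

lemma rotation_mem (hp : ∀ c : ℕ, (c, true) ∈ w ↔ (c, false) ∈ w) {d : Dart} :
    (rotation d).1 ∈ w ↔ d.1 ∈ w := by
  obtain ⟨⟨c, _ | _⟩, _ | _⟩ := d <;> simp [rotation, hp]

lemma faceStep_apply (d : Dart) : faceStep w d = rotation (edgeFlip w d) := rfl

lemma faces_finite (w : List Pass) : (faces w).Finite := by
  have : {d : Dart | d.1 ∈ w}.Finite :=
    ((w.toFinset ×ˢ (Finset.univ : Finset Bool)).finite_toSet).subset fun d hd => by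
      simpa using hd
  refine (this.image fun d => {d' | (faceStep w).SameCycle d d'}).subset ?_
  rintro F ⟨d, hd, rfl⟩
  exact ⟨d, hd, rfl⟩

/-! ### The rational chain complex of faces, edges and double points -/

open Classical in
/-- The function on half-edges that is given by a function on faces. -/
noncomputable def dartLift (w : List Pass) : (faces w → ℚ) →ₗ[ℚ] (Dart → ℚ) where
  toFun H d := if h : d.1 ∈ w then H ⟨_, d, h, rfl⟩ else 0
  map_add' H H' := by
    ext d
    by_cases h : d.1 ∈ w <;> simp [h]
  map_smul' a H := by
    ext d
    by_cases h : d.1 ∈ w <;> simp [h]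

lemma dartLift_faceStep (hp : ∀ c : ℕ, (c, true) ∈ w ↔ (c, false) ∈ w) (H : faces w → ℚ)
    (d : Dart) : dartLift w H (faceStep w d) = dartLift w H d := by
  have hm : (faceStep w d).1 ∈ w ↔ d.1 ∈ w := by
    rw [faceStep_apply, rotation_mem hp, edgeFlip_mem]
  by_cases h : d.1 ∈ w
  · simp only [dartLift, LinearMap.coe_mk, AddHom.coe_mk, h, hm.2 h, dite_true]
    congr 2
    ext d'
    simp
  · simp [dartLift, h, hm]

/-- `edgeFlip w d` and `rotation d` are one `faceStep` apart, hence on the same face. -/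
lemma dartLift_rotation (hp : ∀ c : ℕ, (c, true) ∈ w ↔ (c, false) ∈ w) (H : faces w → ℚ)
    (d : Dart) : dartLift w H (rotation d) = dartLift w H (edgeFlip w d) := by
  rw [← dartLift_faceStep hp H (edgeFlip w d), faceStep_apply, edgeFlip_edgeFlip]

/-- The jump of a function on faces across the edges; the edge that leaves the passage `p` is
represented by `p`. -/
noncomputable def jump (w : List Pass) : (faces w → ℚ) →ₗ[ℚ] ({p // p ∈ w} → ℚ) where
  toFun H p := dartLift w H (edgeFlip w (p, true)) - dartLift w H (p, true)
  map_add' H H' := by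
    ext d
    simp
    ring
  map_smul' a H := by
    ext d
    simp
    ring

/-- Extension by zero of a function on the passages of a word. -/
def extend (w : List Pass) : ({p // p ∈ w} → ℚ) →ₗ[ℚ] (Pass → ℚ) where
  toFun χ p := if h : p ∈ w then χ ⟨p, h⟩ else 0
  map_add' χ χ' := by
    ext p
    by_cases h : p ∈ w <;> simp [h]
  map_smul' a χ := by
    ext p
    by_cases h : p ∈ w <;> simp [h]

lemma extend_apply {p : Pass} (h : p ∈ w) (χ : {p // p ∈ w} → ℚ) :
    extend w χ p = χ ⟨p, h⟩ := by
  simp [extend, h]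

/-- The boundary operator: the outgoing flow minus the incoming flow at each double point. -/
def boundary (w : List Pass) : ({p // p ∈ w} → ℚ) →ₗ[ℚ] ({c // c ∈ labels w} → ℚ) where
  toFun χ c := ∑ b : Bool, (extend w χ (c, b) - extend w χ (w.formPerm⁻¹ (c, b)))
  map_add' χ χ' := by
    ext c
    simp
    ring
  map_smul' a χ := by
    ext c
    simp
    ring

lemma mem_of_mem_labels (hp : ∀ c : ℕ, (c, true) ∈ w ↔ (c, false) ∈ w) {c : ℕ}
    (hc : c ∈ labels w) (b : Bool) : (c, b) ∈ w := by
  obtain ⟨b', hb'⟩ := mem_labels.1 hc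
  cases b <;> cases b' <;> simp_all

/-- The boundary of a boundary is zero: the jumps across the four half-edges around a double point
telescope. -/
lemma range_jump_le (hp : ∀ c : ℕ, (c, true) ∈ w ↔ (c, false) ∈ w) :
    LinearMap.range (jump w) ≤ LinearMap.ker (boundary w) := by
  rintro _ ⟨H, rfl⟩
  ext ⟨c, hc⟩
  have hm := mem_of_mem_labels hp hc
  have hout : ∀ b, extend w (jump w H) (c, b) =
      dartLift w H (rotation ((c, b), true)) - dartLift w H ((c, b), true) := by
    intro b
    rw [extend_apply (hm b), dartLift_rotation hp]
    rfl
  have hin : ∀ b, extend w (jump w H) (w.formPerm⁻¹ (c, b)) =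
      dartLift w H ((c, b), false) - dartLift w H (rotation ((c, b), false)) := by
    intro b
    rw [extend_apply (formPerm_inv_mem.2 (hm b)), dartLift_rotation hp]
    simp [jump, edgeFlip]
  simp only [boundary, LinearMap.coe_mk, AddHom.coe_mk, hout, hin, Fintype.sum_bool, rotation,
    Equiv.coe_fn_mk, Pi.zero_apply]
  ring

/-- Without jumps, the values agree across every edge and all around every double point; following
the curve makes them constant. -/
lemma ker_jump_le (hd : w.Nodup) (hp : ∀ c : ℕ, (c, true) ∈ w ↔ (c, false) ∈ w) :
    LinearMap.ker (jump w) ≤ Submodule.span ℚ {fun _ => 1} := by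
  intro H hH
  have hflip : ∀ p ∈ w, dartLift w H (w.formPerm p, false) = dartLift w H (p, true) := by
    intro p h
    have := congrFun (LinearMap.mem_ker.1 hH) ⟨p, h⟩
    simpa [jump, edgeFlip, sub_eq_zero] using this
  have hin : ∀ p ∈ w, dartLift w H (p, false) = dartLift w H (w.formPerm⁻¹ p, true) := by
    intro p h
    simpa using hflip _ (formPerm_inv_mem.2 h)
  have hrot : ∀ d : Dart, d.1 ∈ w → dartLift w H (rotation d) = dartLift w H d := by
    rintro ⟨p, _ | _⟩ h
    · rw [dartLift_rotation hp, hin p h]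
      rfl
    · rw [dartLift_rotation hp, ← hflip p h]
      rfl
  obtain rfl | ⟨p₀, h₀⟩ := (eq_or_ne w []).imp_right (List.exists_mem_of_ne_nil w)
  · have : H = 0 := by
      ext ⟨F, d, h, -⟩
      simp at h
    simp [this]
  have hvert : ∀ p ∈ w, dartLift w H (p, false) = dartLift w H (p, true) := by
    rintro ⟨c, b⟩ h
    have hm := mem_of_mem_labels hp (mem_labels.2 ⟨b, h⟩)
    have h₁ := hrot ((c, true), true) (hm _)
    have h₂ := hrot ((c, false), true) (hm _)
    have h₃ := hrot ((c, true), false) (hm _)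
    simp only [rotation, Equiv.coe_fn_mk] at h₁ h₂ h₃
    cases b
    · rw [h₃, h₂]
    · rw [h₂, h₁]
  have hall : ∀ p ∈ w, dartLift w H (p, true) = dartLift w H (p₀, true) := by
    refine forall_mem_of_formPerm hd h₀ rfl fun p h ih => ?_
    rw [← hvert _ (List.formPerm_apply_mem_of_mem h), hflip p h, ih]
  rw [Submodule.mem_span_singleton]
  refine ⟨dartLift w H (p₀, true), ?_⟩
  ext ⟨F, ⟨p, b⟩, h, rfl⟩
  have : dartLift w H (p, b) = dartLift w H (p₀, true) := by
    cases b
    · rw [hvert p h, hall p h]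
    · exact hall p h
  rw [Pi.smul_apply, smul_eq_mul, mul_one, ← this]
  simp only [dartLift, LinearMap.coe_mk, AddHom.coe_mk]
  exact dif_pos h

lemma boundary_single (p : {p // p ∈ w}) : boundary w (Pi.single p 1) =
    Pi.single ⟨p.1.1, mem_labels.2 ⟨p.1.2, p.2⟩⟩ 1 -
      Pi.single ⟨(w.formPerm p).1, mem_labels.2 ⟨(w.formPerm p).2,
        List.formPerm_apply_mem_of_mem p.2⟩⟩ 1 := by
  have he : ∀ q, extend w (Pi.single p 1) q = if q = p.1 then 1 else 0 := by
    intro q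
    by_cases h : q ∈ w
    · simp [extend, h, Pi.single_apply, Subtype.ext_iff]
    · have : q ≠ p.1 := by rintro rfl; exact h p.2
      simp [extend, h, this]
  have hb : ∀ (q : Pass) (c : ℕ), ∑ b : Bool, (if (c, b) = q then (1 : ℚ) else 0) =
      if c = q.1 then 1 else 0 := by
    rintro ⟨x, _ | _⟩ c <;> simp only [Fintype.sum_bool, Prod.mk.injEq] <;> simp
  ext ⟨c, hc⟩
  simp only [boundary, LinearMap.coe_mk, AddHom.coe_mk, he, Equiv.Perm.inv_eq_iff_eq,
    Finset.sum_sub_distrib, hb, Pi.sub_apply, Pi.single_apply, Subtype.mk.injEq]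

/-- The boundary of an edge is the difference of its end points. Following the curve, these
differences and one base vertex span everything, which accounts for the `+ 1`. -/
lemma card_labels_le_finrank_range_boundary (hd : w.Nodup) :
    (labels w).card ≤ Module.finrank ℚ (LinearMap.range (boundary w)) + 1 := by
  obtain rfl | ⟨p₀, h₀⟩ := (eq_or_ne w []).imp_right (List.exists_mem_of_ne_nil w)
  · simp [labels]
  let v₀ : {c // c ∈ labels w} → ℚ := Pi.single ⟨p₀.1, mem_labels.2 ⟨p₀.2, h₀⟩⟩ 1
  have key : ∀ p ∈ w, ∀ h : p.1 ∈ labels w,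
      (Pi.single ⟨p.1, h⟩ 1 : {c // c ∈ labels w} → ℚ) ∈
        LinearMap.range (boundary w) ⊔ Submodule.span ℚ {v₀} := by
    refine forall_mem_of_formPerm hd h₀ ?_ ?_
    · intro h
      exact Submodule.mem_sup_right (Submodule.mem_span_singleton_self _)
    · intro p hp ih h
      have h₁ := ih (mem_labels.2 ⟨p.2, hp⟩)
      have h₂ : boundary w (Pi.single ⟨p, hp⟩ 1) ∈
          LinearMap.range (boundary w) ⊔ Submodule.span ℚ {v₀} :=
        Submodule.mem_sup_left ⟨_, rfl⟩
      rw [boundary_single] at h₂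
      have := Submodule.sub_mem _ h₁ h₂
      simpa using this
  have htop : LinearMap.range (boundary w) ⊔ Submodule.span ℚ {v₀} = ⊤ := by
    rw [eq_top_iff, ← (Pi.basisFun ℚ {c // c ∈ labels w}).span_eq, Submodule.span_le]
    rintro _ ⟨⟨c, hc⟩, rfl⟩
    obtain ⟨b, hb⟩ := mem_labels.1 hc
    rw [Pi.basisFun_apply]
    exact key (c, b) hb hc
  have h₁ := Submodule.finrank_add_le_finrank_add_finrank (LinearMap.range (boundary w))
    (Submodule.span ℚ {v₀})
  have h₂ : Module.finrank ℚ (Submodule.span ℚ {v₀}) ≤ 1 := by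
    simpa using finrank_span_le_card (R := ℚ) ({v₀} : Set ({c // c ∈ labels w} → ℚ))
  rw [htop, finrank_top, Module.finrank_fintype_fun_eq_card, Fintype.card_coe] at h₁
  omega

/-- With V, E, F the numbers of double points, edges and faces, the range has dimension at least F -
1 and the kernel at most E - V + 1. Euler characteristic 2 makes these bounds equal. -/
lemma range_jump_eq (hd : w.Nodup) (hp : ∀ c : ℕ, (c, true) ∈ w ↔ (c, false) ∈ w)
    (hpl : ((labels w).card : ℤ) - (w.length : ℤ) + ((faces w).ncard : ℤ) = 2) :
    LinearMap.range (jump w) = LinearMap.ker (boundary w) := by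
  have := (faces_finite w).to_subtype
  have := Fintype.ofFinite (faces w)
  have hF : Fintype.card (faces w) = (faces w).ncard := by
    rw [← Nat.card_eq_fintype_card]
    rfl
  have hE : Fintype.card {p // p ∈ w} = w.length := by
    rw [← List.toFinset_card_of_nodup hd, ← Fintype.card_coe]
    exact Fintype.card_congr (Equiv.subtypeEquivRight (by simp))
  refine Submodule.eq_of_le_of_finrank_le (range_jump_le hp) ?_
  have h₁ := LinearMap.finrank_range_add_finrank_ker (jump w)
  have h₂ := LinearMap.finrank_range_add_finrank_ker (boundary w)
  have h₃ := Submodule.finrank_mono (ker_jump_le hd hp)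
  have h₄ := finrank_span_le_card (R := ℚ) ({fun _ => 1} : Set (faces w → ℚ))
  have h₅ := card_labels_le_finrank_range_boundary hd
  rw [Module.finrank_fintype_fun_eq_card] at h₁ h₂
  simp only [Set.toFinset_singleton, Finset.card_singleton] at h₄
  omega

/-- The half-edges of a planar word have an Alexander numbering. -/
lemma exists_alexander_numbering (hd : w.Nodup)
    (hp : ∀ c : ℕ, (c, true) ∈ w ↔ (c, false) ∈ w) (hpl : IsPlanar w) :
    ∃ A : Dart → ℚ, (∀ d, A (rotation d) = A (edgeFlip w d)) ∧
      ∀ p ∈ w, A (w.formPerm p, false) = A (p, true) + 1 := by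
  rcases hpl with rfl | hpl
  · exact ⟨0, by simp, by simp⟩
  -- Two edges leave and two enter each double point, so the unit flow is conserved.
  have hone : (fun _ => 1 : {p // p ∈ w} → ℚ) ∈ LinearMap.ker (boundary w) := by
    ext ⟨c, hc⟩
    have hm := mem_of_mem_labels hp hc
    simp only [boundary, LinearMap.coe_mk, AddHom.coe_mk, extend_apply (hm _),
      extend_apply (formPerm_inv_mem.2 (hm _))]
    simp
  rw [← range_jump_eq hd hp hpl] at hone
  obtain ⟨H, hH⟩ := hone
  refine ⟨dartLift w H, dartLift_rotation hp H, fun p h => ?_⟩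
  have := congrFun hH ⟨p, h⟩
  simp only [jump, LinearMap.coe_mk, AddHom.coe_mk, edgeFlip, Equiv.coe_fn_mk] at this
  linarith

/-- Telescoping along the linear word; no condition at the base point is needed. -/
lemma height_eq_of_step {g : Pass → ℤ} {R : Pass → ℚ} :
    ∀ {w : List Pass}, w.Nodup →
      (∀ (i : ℕ) (h : i + 1 < w.length), R w[i + 1] = R w[i] - g w[i]) →
      ∀ p ∈ w, ∀ h : 0 < w.length, (height g w p : ℚ) = R w[0] - R p
  | [], _, _ => by simp
  | [a], _, _ => by simp
  | a :: b :: w, hd, hs => by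
    intro p hp _
    by_cases ha : a = p
    · simp [ha]
    · have hp' : p ∈ b :: w := by simpa [Ne.symm ha] using hp
      have ih := height_eq_of_step (g := g) (R := R) (w := b :: w) hd.of_cons
        (fun i h => hs (i + 1) (by simpa using h)) p hp' (by simp)
      have h₀ := hs 0 (by simp)
      simp only [List.getElem_cons_zero, List.getElem_cons_succ] at ih h₀ ⊢
      rw [height_cons, if_neg ha]
      push_cast
      rw [ih]
      linarith

/-- In a planar word without virtual crossings, all intersection indices vanish. -/
lemma index_eq_zero_of_isPlanar {k : ℕ → CrossingKind} (hd : w.Nodup)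
    (hp : ∀ c : ℕ, (c, true) ∈ w ↔ (c, false) ∈ w) (hpl : IsPlanar w)
    (hk : ∀ c ∈ labels w, k c ≠ .virtual) {c : ℕ} (hc : c ∈ labels w) : index k w c = 0 := by
  obtain ⟨A, hrot, hjump⟩ := exists_alexander_numbering hd hp hpl
  -- `R p` is the lower of the two face values beside the edge that enters `p`.
  let R : Pass → ℚ := fun p => A (w.formPerm⁻¹ p, true)
  have hin : ∀ p ∈ w, A (p, false) = R p + 1 := by
    intro p h
    have := hjump _ (formPerm_inv_mem.2 h)
    simp only [← Equiv.Perm.mul_apply, mul_inv_cancel, Equiv.Perm.one_apply] at this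
    exact this
  have hinr : ∀ p, A (rotation (p, false)) = R p := fun p => hrot (p, false)
  -- The four faces around a double point determine one another: each passage lowers `R` by its
  -- sign, and the two incoming values differ by exactly the 1 subtracted in `index`.
  have hcross : ∀ x ∈ labels w, R (x, true) = R (x, false) + 1 ∧
      A ((x, true), true) = R (x, true) - 1 ∧ A ((x, false), true) = R (x, false) + 1 := by
    intro x hx
    have hm := mem_of_mem_labels hp hx
    have h₁ := hinr (x, true)
    have h₂ := hinr (x, false)
    have h₃ := hin _ (hm true)
    have h₄ := hin _ (hm false)
    have h₅ := hrot ((x, false), true)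
    have h₆ := hjump _ (hm false)
    simp only [rotation, edgeFlip, Equiv.coe_fn_mk] at h₁ h₂ h₅
    refine ⟨?_, ?_, ?_⟩ <;> linarith
  have hstep : ∀ (i : ℕ) (h : i + 1 < w.length), R w[i + 1] = R w[i] - passSign k w[i] := by
    intro i h
    have hm : w[i] ∈ w := List.getElem_mem _
    have e : w.formPerm⁻¹ w[i + 1] = w[i] := by
      rw [Equiv.Perm.inv_eq_iff_eq, List.formPerm_apply_lt_getElem w hd i h]
    have hl : w[i].1 ∈ labels w := mem_labels.2 ⟨w[i].2, hm⟩
    have : R w[i + 1] = A (w[i], true) := by simp only [R, e]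
    rw [this]
    obtain ⟨-, h₁, h₂⟩ := hcross _ hl
    have hv := hk _ hl
    generalize w[i] = p at *
    obtain ⟨x, _ | _⟩ := p
    · rw [h₂]; simp [passSign, hv]
    · rw [h₁]; simp [passSign, hv]
  have hm := mem_of_mem_labels hp hc
  have hpos : 0 < w.length := List.length_pos_of_mem (hm true)
  have h₁ := height_eq_of_step hd hstep _ (hm true) hpos
  have h₂ := height_eq_of_step hd hstep _ (hm false) hpos
  have h₃ := (hcross c hc).1
  have : ((index k w c : ℤ) : ℚ) = 0 := by
    simp only [index]
    push_cast
    rw [h₁, h₂]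
    linarith
  exact_mod_cast this

end planar

/-! ### Vanishing on classical knots -/

lemma VirtualDiagram.IsClassical.indexWrithe_eq_zero {D : VirtualDiagram} (h : D.IsClassical)
    {m : ℕ} (hm : 0 < m) : indexWrithe m D.kind D.word = 0 := by
  -- Nonemptiness makes the infimum attained; `sInf ∅ = 0` would carry no information.
  have hne : {n | ∃ D' : VirtualDiagram, Equivalent D D' ∧ D'.virtualCrossings.card = n}.Nonempty :=
    ⟨_, D, Relation.EqvGen.refl D, rfl⟩
  obtain ⟨D', hD', h₀⟩ := Nat.sInf_mem hne
  have h₁ : D'.virtualCrossings = ∅ := Finset.card_eq_zero.1 (h₀.trans h)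
  have hk : ∀ c ∈ labels D'.word, D'.kind c ≠ .virtual := by
    intro c hc hv
    have : c ∈ D'.virtualCrossings := Finset.mem_filter.2 ⟨hc, hv⟩
    simp [h₁] at this
  rw [hD'.indexWrithe_eq hm]
  unfold indexWrithe
  refine List.sum_eq_zero fun x hx => ?_
  obtain ⟨p, hp, rfl⟩ := List.mem_map.1 hx
  have h₂ := index_eq_zero_of_isPlanar D'.nodup D'.paired D'.planar hk
    (mem_labels.2 ⟨p.2, hp⟩ : p.1 ∈ labels D'.word)
  have h₃ : (0 : ℤ) ≠ m := by exact_mod_cast hm.ne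
  simp only [writheTerm, h₂, abs_zero, h₃, and_false, if_false]

/-! ## The intersection index in terms of heights -/

lemma toFinset_eq_labels_product {w : List Pass}
    (hp : ∀ c : ℕ, (c, true) ∈ w ↔ (c, false) ∈ w) : w.toFinset = labels w ×ˢ Finset.univ := by
  ext ⟨c, b⟩
  simp only [List.mem_toFinset, Finset.mem_product, Finset.mem_univ, and_true]
  exact ⟨fun h => mem_labels.2 ⟨b, h⟩, fun h => mem_of_mem_labels hp h b⟩

lemma indexWrithe_eq_sum_labels (m : ℕ) (k : ℕ → CrossingKind) {w : List Pass} (hd : w.Nodup)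
    (hp : ∀ c : ℕ, (c, true) ∈ w ↔ (c, false) ∈ w) :
    indexWrithe m k w = ∑ c ∈ labels w, if |index k w c| = m then (k c).sign else 0 := by
  rw [indexWrithe, ← List.sum_toFinset _ hd, toFinset_eq_labels_product hp, Finset.sum_product]
  simp [writheTerm]

namespace VirtualPseudodiagram

variable (P : VirtualPseudodiagram)

/-- A crossing with both passages on `L₁` contributes opposite signs, so only crossings with the
other component survive. -/
lemma shadowLinkingNumber_eq_sum {c : ℕ} {L₁ L₂ : List Pass} (hd : (L₁ ++ L₂).Nodup)
    (hc : ∀ b, (c, b) ∉ L₁) (hL : ∀ p : Pass, p.1 ≠ c → (p ∈ L₁ ++ L₂ ↔ p ∈ P.word)) :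
    P.shadowLinkingNumber L₁ L₂ = (L₁.map (passSign P.kind)).sum := by
  have hd' := List.nodup_append'.1 hd
  have hsub : ∀ p ∈ L₁, p ∈ P.word := fun p hp =>
    (hL p (by rintro rfl; exact hc p.2 hp)).1 (by simp [hp])
  have hterm : ∀ x ∈ P.classicalCrossings,
      ((if (x, true) ∈ L₁ ∧ (x, false) ∈ L₂ then 1 else 0)
        - (if (x, false) ∈ L₁ ∧ (x, true) ∈ L₂ then 1 else 0) : ℤ) =
      ∑ b : Bool, if (x, b) ∈ L₁ then passSign P.kind (x, b) else 0 := by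
    intro x hx
    obtain ⟨hx, hv⟩ := Finset.mem_filter.1 hx
    have hm := mem_of_mem_labels P.paired hx
    by_cases hxc : x = c
    · subst hxc
      simp [hc]
    · have h₁ := (hL (x, true) hxc).2 (hm true)
      have h₂ := (hL (x, false) hxc).2 (hm false)
      have h₃ : (x, true) ∈ L₁ → (x, true) ∉ L₂ := fun h h' => hd'.2.2 h h'
      have h₄ : (x, false) ∈ L₁ → (x, false) ∉ L₂ := fun h h' => hd'.2.2 h h'
      simp only [List.mem_append] at h₁ h₂
      by_cases h₅ : (x, true) ∈ L₁ <;> by_cases h₆ : (x, false) ∈ L₁ <;>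
        simp_all [passSign]
  rw [shadowLinkingNumber, Finset.sum_congr rfl hterm,
    ← Finset.sum_product P.classicalCrossings Finset.univ
      (fun p : Pass => if p ∈ L₁ then passSign P.kind p else 0),
    ← List.sum_toFinset _ hd'.1, ← Finset.sum_filter]
  refine Finset.sum_subset (fun p hp => by simpa using (Finset.mem_filter.1 hp).2) ?_
  rintro ⟨x, b⟩ hx hx'
  rw [List.mem_toFinset] at hx
  have hv : P.kind x = .virtual := by
    by_contra h
    refine hx' (Finset.mem_filter.2 ⟨?_, hx⟩)
    simp only [Finset.mem_product, Finset.mem_univ, and_true]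
    exact Finset.mem_filter.2 ⟨mem_labels.2 ⟨b, hsub _ hx⟩, h⟩
  simp [passSign, hv]

lemma ind_eq_index {c : ℕ} (hc : c ∈ P.classicalCrossings) :
    P.ind c = index P.kind P.word c := by
  obtain ⟨hc, hv⟩ := Finset.mem_filter.1 hc
  have hm := mem_of_mem_labels P.paired hc
  obtain ⟨u, v, hw, hu⟩ := List.eq_append_cons_of_mem (hm true)
  have hd := P.nodup
  have hs := sum_eq_zero_of_paired P.nodup P.paired (passSign_add P.kind)
  have hf := hm false
  have hperm : P.word.Perm ((c, true) :: (v ++ u)) := by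
    rw [hw]
    exact List.perm_middle.trans (List.perm_append_comm.cons _)
  have hd' := hperm.nodup_iff.1 hd
  have hf' : (c, false) ∈ v ++ u := by simpa using hperm.mem_iff.1 hf
  have hidx : P.word.idxOf (c, true) = u.length := by
    rw [hw, List.idxOf_append_of_notMem hu]
    simp
  have htail : (P.word.rotate (P.word.idxOf (c, true))).tail = v ++ u := by
    rw [hidx, hw, List.rotate_append_length_eq]
    rfl
  obtain ⟨a, b, hab, ha⟩ := List.eq_append_cons_of_mem hf'
  have hpos : ∀ p ∈ a, decide (p ≠ (c, false)) = true := by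
    intro p hp
    simp only [decide_eq_true_eq]
    rintro rfl
    exact ha hp
  have h₁ : (v ++ u).takeWhile (· ≠ (c, false)) = a := by
    rw [hab, List.takeWhile_append_of_pos hpos]
    simp
  have h₂ : ((v ++ u).dropWhile (· ≠ (c, false))).tail = b := by
    rw [hab, List.dropWhile_append_of_pos hpos]
    simp
  have hsm : P.smoothing c = (a, b) := by
    simp only [smoothing, htail, h₁, h₂]
  have hdab : ((c, true) :: (a ++ (c, false) :: b)).Nodup := hab ▸ hd'
  have hnd : (a ++ b).Nodup :=
    hdab.of_cons.sublist ((List.sublist_cons_self _ _).append_left _)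
  have hca : ∀ s, (c, s) ∉ a := by
    intro s
    cases s
    · exact ha
    · intro h
      simp [h] at hdab
  rw [ind, hsm, P.shadowLinkingNumber_eq_sum hnd hca]
  · have hsum : (a.map (passSign P.kind)).sum = height (passSign P.kind) (v ++ u) (c, false) := by
      rw [height, h₁]
    -- Cutting just after `(c, true)` puts its own sign 1 into the rotated part; this is the `- 1`
    -- in `index`.
    have hw' : P.word = (u ++ [(c, true)]) ++ v := by simp [hw]
    have hrot := height_rotate (g := passSign P.kind) (u := u ++ [(c, true)]) (v := v)
      (p := (c, false)) (hw' ▸ hs) (hw' ▸ hd) (hw' ▸ hf)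
    rw [← hw', ← List.append_assoc, height_append_of_mem hf'] at hrot
    have ht : height (passSign P.kind) P.word (c, true) = (u.map (passSign P.kind)).sum := by
      rw [hw, height_append_of_notMem hu]
      simp
    have hone : passSign P.kind (c, true) = 1 := by simp [passSign, hv]
    rw [hsum, hrot, index, ht]
    simp [hone]
    ring
  · intro p hp
    rw [hperm.mem_iff, hab]
    have h₃ : p ≠ (c, true) := by rintro rfl; exact hp rfl
    have h₄ : p ≠ (c, false) := by rintro rfl; exact hp rfl
    simp [h₃, h₄]

/-! ## The upper bound for the virtualizing number -/

variable {P}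

/-- The pseudodiagram obtained by resolving the crossings in `T` positively. -/
def resolvePositive (P : VirtualPseudodiagram) (T : Finset ℕ) : VirtualPseudodiagram where
  word := P.word
  kind c := if c ∈ T then .positive else P.kind c
  nodup := P.nodup
  paired := P.paired
  planar := P.planar

lemma isResolution_resolvePositive {T : Finset ℕ} (hT : ∀ c ∈ T, P.kind c = .undetermined) :
    P.IsResolution (P.resolvePositive T) := by
  refine ⟨rfl, fun c _ => ?_⟩
  by_cases h : c ∈ T
  · exact .inr ⟨hT c h, .inl (by simp [resolvePositive, h])⟩
  · exact .inl (by simp [resolvePositive, h])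

lemma resolvedCrossings_resolvePositive_subset (T : Finset ℕ) :
    P.resolvedCrossings (P.resolvePositive T) ⊆ T := by
  intro c hc
  obtain ⟨h₁, h₂⟩ := Finset.mem_filter.1 hc
  by_contra h
  exact h₂ (by simpa [resolvePositive, h] using (Finset.mem_filter.1 h₁).2)

/-- Crossings of `T` contribute 1 each and the fewer remaining ones at least -1 each, so the index
writhe stays positive. -/
lemma necessarilyNonclassical_resolvePositive (hP : P.IsVirtualShadow) {m : ℕ} (hm : 0 < m)
    {T : Finset ℕ} (hT : T ⊆ P.crossingsOfIndex m)
    (hcard : (P.crossingsOfIndex m).card < 2 * T.card) :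
    (P.resolvePositive T).NecessarilyNonclassical := by
  rintro D ⟨hw, hk⟩ hD
  replace hw : D.word = P.word := hw
  have hund : ∀ c ∈ P.crossingsOfIndex m, P.kind c = .undetermined := fun c hc =>
    hP c (Finset.mem_filter.1 hc).1
  -- Resolution creates and removes no virtual crossing, so the indices in `D` are those in `P`.
  have hvirt : ∀ c ∈ labels P.word, (D.kind c = .virtual ↔ P.kind c = .virtual) := by
    intro c hc
    by_cases h : c ∈ T
    · have h₁ := hund c (hT h)
      have h₂ := hk c hc
      simp only [resolvePositive, h, if_true, reduceCtorEq, false_and, or_false] at h₂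
      simp [h₁, h₂]
    · have h₂ := hk c hc
      simp only [resolvePositive, h, if_false] at h₂
      rcases h₂ with h₂ | ⟨h₂, h₃ | h₃⟩
      · rw [h₂]
      · simp [h₂, h₃]
      · simp [h₂, h₃]
  have hwr : indexWrithe m D.kind D.word = ∑ c ∈ P.crossingsOfIndex m, (D.kind c).sign := by
    rw [indexWrithe_eq_sum_labels m D.kind D.nodup D.paired, hw, crossingsOfIndex,
      classicalCrossings, Finset.filter_filter, Finset.sum_filter]
    refine Finset.sum_congr rfl fun c hc => ?_
    rw [index_congr hvirt c]
    by_cases hv : P.kind c = .virtual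
    · simp [hv, (hvirt c hc).2 hv, CrossingKind.sign]
    · rw [← P.ind_eq_index (Finset.mem_filter.2 ⟨hc, hv⟩)]
      simp [hv]
  have hpos : ∀ c ∈ T, (D.kind c).sign = 1 := by
    intro c hc
    have h₂ := hk c (Finset.mem_filter.1 (Finset.mem_filter.1 (hT hc)).1).1
    simp only [resolvePositive, hc, if_true, reduceCtorEq, false_and, or_false] at h₂
    simp [h₂, CrossingKind.sign]
  have hge : ∀ c, -1 ≤ (D.kind c).sign := by
    intro c
    cases D.kind c <;> simp [CrossingKind.sign]
  have h₀ := hD.indexWrithe_eq_zero hm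
  rw [hwr, ← Finset.sum_sdiff hT, Finset.sum_congr rfl hpos] at h₀
  have h₁ := Finset.card_nsmul_le_sum (P.crossingsOfIndex m \ T) (fun c => (D.kind c).sign) (-1)
    fun c _ => hge c
  have h₂ := Finset.card_sdiff_add_card_eq_card hT
  simp only [Finset.sum_const, nsmul_eq_mul, mul_one, mul_neg] at h₀ h₁
  omega

lemma vir_le_card_div_two_add_one (hP : P.IsVirtualShadow) {m : ℕ} (hm : 0 < m)
    (hne : (P.crossingsOfIndex m).Nonempty) :
    P.vir ≤ ((P.crossingsOfIndex m).card / 2 + 1 : ℕ) := by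
  have hpos := hne.card_pos
  obtain ⟨T, hT, hc⟩ := Finset.exists_subset_card_eq
    -- This fails for an empty set; nonemptiness is needed here.
    (show (P.crossingsOfIndex m).card / 2 + 1 ≤ (P.crossingsOfIndex m).card by omega)
  refine iInf₂_le_of_le (P.resolvePositive T)
    ⟨isResolution_resolvePositive fun c h => hP c (Finset.mem_filter.1 (hT h)).1,
      necessarilyNonclassical_resolvePositive hP hm hT (by omega)⟩ ?_
  rw [← hc]
  exact_mod_cast Finset.card_le_card (resolvedCrossings_resolvePositive_subset T)

end VirtualPseudodiagram

end VirtualKnot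

theorem mainTheorem10 (S : VirtualKnot.VirtualPseudodiagram) (hS : S.IsVirtualShadow)
    (hind : ∃ c ∈ S.precrossings, S.ind c ≠ 0) :
    (S.vir : ℝ≥0∞) ≤
      ⨅ (m : ℕ) (_ : 0 < m ∧ ∃ c ∈ S.precrossings, |S.ind c| = m),
        (((S.crossingsOfIndex m).card : ℝ≥0∞) / 2 + 1) := by
  refine le_iInf₂ ?_
  rintro m ⟨hm, c, hc, hcm⟩
  obtain ⟨hc, hk⟩ := Finset.mem_filter.1 hc
  have hne : (S.crossingsOfIndex m).Nonempty :=
    ⟨c, Finset.mem_filter.2 ⟨Finset.mem_filter.2 ⟨hc, by simp [hk]⟩, hcm⟩⟩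
  refine (ENat.toENNReal_le.2
    (VirtualKnot.VirtualPseudodiagram.vir_le_card_div_two_add_one hS hm hne)).trans ?_
  rw [ENat.toENNReal_coe, Nat.cast_add, Nat.cast_one]
  gcongr
  -- It remains to compare the rounded-down half with the exact one.
  rw [ENNReal.le_div_iff_mul_le (by simp) (by simp)]
  exact_mod_cast Nat.div_mul_le_self _ 2
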